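/- Let $d$ be a natural number and let $\Lambda^m$ ($0\le m\le d$) be the $m$-th exterior power of $\mathbb R^d$ (so $\Lambda^0=\mathbb R$), with the inner product $\langle\cdot\mid\cdot\rangle$ for which the vectors $e_{i_1}\wedge\dots\wedge e_{i_m}$, $i_1<\dots<i_m$, are orthonormal, where $e_1,\dots,e_d$ is the standard basis of $\mathbb R^d$. A linear map $S$ of $\mathbb R^d$ acts on $\Lambda^m$ by $S(v_1\wedge\dots\wedge v_m)=Sv_1\wedge\dots\wedge Sv_m$. An $m$-vector is decomposable if it is of the form $v_1\wedge\dots\wedge v_m$ with $v_1,\dots,v_m\in\mathbb R^d$. Let $\mathcal T$ be a set of linear maps $\mathbb R^d\to\mathbb R^d$ and let $0\le s\le d$. If $s=m$ is an integer, $\mathcal T$ satisfies condition $C(s)$ if for all non-zero decomposable $\mathbf v,\mathbf w\in\Lambda^m$ there is $S\in\mathcal T$ with $\langle S\mathbf v\mid\mathbf w\rangle\neq0$. If $s$ is not an integer and $m$ is its integer part, $\mathcal T$ satisfies condition $C(s)$ if for all non-zero decomposable $\mathbf v,\mathbf w\in\Lambda^m$ and all $v,w\in\mathbb R^d$ with $\mathbf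 v\wedge v\ne0$ and $\mathbf w\wedge w\neq0$ there is $S\in\mathcal T$ such that both $\langle S\mathbf v\mid\mathbf w\rangle\ne0$ and $\langle S(\mathbf v\wedge v)\mid\mathbf w\wedge w\rangle\neq0$. Put $n_0=\max_{0\le m\le d}\binom dm$. Let $k\ge2$, and identify the space of families $\mathcal F=(S_1,\dots,S_k)$ of linear maps of $\mathbb R^d$ with $\mathbb R^{d^2k}$ through matrix entries. For such $\mathcal F$ let $$\mathcal S_l(\mathcal F)=\{S_{i_1}\circ\dots\circ S_{i_j}\mid 1\le j\le l,\ i_1,\dots,i_j\in\{1,\dots,k\}\}.$$ Then the set $$\mathcal C=\{\mathcal F\in\mathbb R^{d^2k}\mid \mathcal S_{2n_0^2}(\mathcal F)\text{ satisfies }C(s)\text{ for all }0\le s\le d\}$$ is open and dense in $\mathbb R^{d^2k}$ and has full Lebesgue measure, that is, its complement is a Lebesgue null set. Moreover, $\mathbb R^{d^2k}\setminus\mathcal C$ is contained in a finite union of $(d^2k-1)$-dimensional real algebraic varieties in $\mathbb R^{d^2k}$ (common zero sets of families of real polynomials, the dimension being the Krull dimension of the ring of polynomial functions on the variety). -/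

import Mathlib

noncomputable section

namespace FalconerSloan

/-- `ℝ^d` with its Euclidean inner product. -/
abbrev E (d : ℕ) : Type := EuclideanSpace ℝ (Fin d)

/-- `Λ^m`, the `m`-th exterior power of `ℝ^d`. Its inner product is Mathlib's: the one for which
the vectors `e_{i_1} ∧ ⋯ ∧ e_{i_m}`, `i_1 < ⋯ < i_m`, form an orthonormal basis
(`OrthonormalBasis.exteriorPower`). A linear map `S` of `ℝ^d` acts on it by `exteriorPower.map m S`,
that is, `S (v_1 ∧ ⋯ ∧ v_m) = S v_1 ∧ ⋯ ∧ S v_m`. -/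
abbrev Ext (d m : ℕ) : Type := ⋀[ℝ]^m (E d)

/-- The `m`-vector `v` is decomposable: `v = v_1 ∧ ⋯ ∧ v_m` for some `v_1, …, v_m ∈ ℝ^d`. -/
def IsDecomposable {d m : ℕ} (v : Ext d m) : Prop :=
  ∃ a : Fin m → E d, exteriorPower.ιMulti ℝ m a = v

/-- The `(m+1)`-vector `v ∧ x` for an `m`-vector `v` and a vector `x ∈ ℝ^d`
(product in the exterior algebra). -/
def wedge {d m : ℕ} (v : Ext d m) (x : E d) : Ext d (m + 1) :=
  ⟨(v : ExteriorAlgebra ℝ (E d)) * ExteriorAlgebra.ι ℝ x, by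
    have h := Submodule.mul_mem_mul v.2 (LinearMap.mem_range_self (ExteriorAlgebra.ι ℝ) x)
    rwa [← pow_succ] at h⟩

/-- Condition `C(m)` for an integer parameter `m`. -/
def ConditionCNat {d : ℕ} (T : Set (E d →ₗ[ℝ] E d)) (m : ℕ) : Prop :=
  ∀ v w : Ext d m, IsDecomposable v → IsDecomposable w → v ≠ 0 → w ≠ 0 →
    ∃ S ∈ T, inner ℝ (exteriorPower.map m S v) w ≠ 0

/-- Condition `C(s)` for a non-integral parameter `s` with integer part `m`. -/
def ConditionCBetween {d : ℕ} (T : Set (E d →ₗ[ℝ] E d)) (m : ℕ) : Prop :=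
  ∀ (v w : Ext d m) (x y : E d), IsDecomposable v → IsDecomposable w → v ≠ 0 → w ≠ 0 →
    wedge v x ≠ 0 → wedge w y ≠ 0 →
      ∃ S ∈ T, inner ℝ (exteriorPower.map m S v) w ≠ 0 ∧
        inner ℝ (exteriorPower.map (m + 1) S (wedge v x)) (wedge w y) ≠ 0

/-- The Falconer-Sloan condition `C(s)`, for `0 ≤ s ≤ d`, of a family `T` of linear maps of `ℝ^d`:
the first clause applies if `s` is an integer, the second one if it is not. -/
def ConditionC {d : ℕ} (T : Set (E d →ₗ[ℝ] E d)) (s : ℝ) : Prop :=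
  (∀ m : ℕ, s = m → ConditionCNat T m) ∧
    (∀ m : ℕ, (m : ℝ) < s → s < m + 1 → ConditionCBetween T m)

/-- `n_0 = max_{0 ≤ m ≤ d} (d choose m)`. -/
def n₀ (d : ℕ) : ℕ := (Finset.range (d + 1)).sup fun m => d.choose m

/-- `ℝ^{d²k}`, the coordinates being the entries of `k` matrices of size `d × d`. -/
abbrev FamilySpace (d k : ℕ) : Type := Fin k × Fin d × Fin d → ℝ

/-- The `i`-th linear map of the family with coordinates `𝓕`. -/
def member {d k : ℕ} (𝓕 : FamilySpace d k) (i : Fin k) : E d →ₗ[ℝ] E d :=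
  Matrix.toEuclideanLin (Matrix.of fun a b => 𝓕 (i, a, b))

/-- The set `{S_{i_1} ∘ ⋯ ∘ S_{i_j} | 1 ≤ j ≤ l}` of all compositions of maps of the family up to
length `l` (the product of `Module.End ℝ (E d)` is composition). -/
def compositions {d k : ℕ} (l : ℕ) (𝓕 : FamilySpace d k) : Set (E d →ₗ[ℝ] E d) :=
  {T | ∃ j : ℕ, 1 ≤ j ∧ j ≤ l ∧ ∃ i : Fin j → Fin k,
    T = (List.ofFn fun q => (member 𝓕 (i q) : Module.End ℝ (E d))).prod}

/-- The set `𝓒` of the families for which the compositions up to length `2 n_0²` satisfy `C(s)` for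
all `0 ≤ s ≤ d`. -/
def typicalSet (d k : ℕ) : Set (FamilySpace d k) :=
  {𝓕 | ∀ s : ℝ, 0 ≤ s → s ≤ d → ConditionC (compositions (2 * n₀ d ^ 2) 𝓕) s}

/-- `V ⊆ ℝ^σ` is a real algebraic variety: the set of common zeros of an ideal of polynomials. -/
def IsAlgebraicVariety {σ : Type*} (V : Set (σ → ℝ)) : Prop :=
  ∃ I : Ideal (MvPolynomial σ ℝ), V = MvPolynomial.zeroLocus ℝ I

/-- The dimension of a real algebraic variety `V`: the Krull dimension of the ring of polynomial
functions on `V` (which is `⊥` if `V` is empty). -/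
def algebraicDim {σ : Type*} (V : Set (σ → ℝ)) : WithBot ℕ∞ :=
  ringKrullDim (MvPolynomial σ ℝ ⧸ MvPolynomial.vanishingIdeal ℝ V)

end FalconerSloan

end

/-! Bad families are shown to lie in the zero set of one non-zero polynomial; this gives the null
complement, hence density, and the covering by a variety. Openness is separate: by Gram–Schmidt and
rescaling, each condition need only be tested on pairs of orthonormal frames, which form a compact
set, and non-vanishing of a continuous function persists nearby.

For fixed frames, `frameDet` is a polynomial of degree at most `d` in the entries of `S`, and the
non-integral conditions involve a product of two of these. All such polynomials lie in the
finite-dimensional space of polynomials of degree at most `2 * d`. If some family generates a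
Zariski dense semigroup of matrices, then finitely many of its words separate this space. That
separation is the non-vanishing of a determinant polynomial in the family, so it holds off a
hypersurface, for all frames at once (`exists_polynomial_forall_exists_word`).

A dense semigroup is generated by a diagonal matrix with distinct prime entries and a unipotent
matrix `1 + Y` with `Y * Y = 0`: its Zariski closure contains all diagonal matrices and all
transvections, hence every matrix (`eq_zero_of_forall_evalMatrix_eq_zero`). The words obtained have
no useful length bound; `exists_word_length_le_finrank` shortens them, applied on an exterior power
or on a tensor product of two consecutive ones. -/

noncomputable section

namespace FalconerSloan

/-! ### Zero sets of polynomials: measure and dimension -/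

section PolynomialZeros

open MvPolynomial MeasureTheory

/-- The zero set of a non-zero real polynomial is a Lebesgue null set. -/
theorem volume_eval_eq_zero {σ : Type*} [Fintype σ] {p : MvPolynomial σ ℝ} (hp : p ≠ 0) :
    volume {x : σ → ℝ | eval x p = 0} = 0 := by
  obtain ⟨x₀, hx₀⟩ : ∃ x, eval x p ≠ 0 := by
    by_contra! h
    exact hp (MvPolynomial.funext fun x => by simp [h x])
  have hc : Continuous fun q : ℝ × (σ → ℝ) => eval (x₀ + q.1 • q.2) p :=
    (MvPolynomial.continuous_eval p).comp (by fun_prop)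
  have hA : MeasurableSet {q : ℝ × (σ → ℝ) | eval (x₀ + q.1 • q.2) p = 0} :=
    (isClosed_eq hc continuous_const).measurableSet
  have hline : ∀ x : σ → ℝ, volume {t : ℝ | eval (x₀ + t • x) p = 0} = 0 := by
    intro x
    let q : Polynomial ℝ := aeval (fun i => Polynomial.C (x₀ i) + Polynomial.X * Polynomial.C (x i)) p
    have hq : ∀ t : ℝ, q.eval t = eval (x₀ + t • x) p := by
      intro t
      have : (Polynomial.aeval t).comp
          (aeval (fun i => Polynomial.C (x₀ i) + Polynomial.X * Polynomial.C (x i))) =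
          aeval (R := ℝ) (x₀ + t • x) := by
        ext i
        simp
        ring
      simpa [q, Polynomial.coe_aeval_eq_eval, MvPolynomial.coe_aeval_eq_eval] using
        DFunLike.congr_fun this p
    have hq0 : q ≠ 0 := by
      intro h
      apply hx₀
      have := hq 0
      simpa [h] using this.symm
    refine (Set.Finite.subset (q.roots.toFinset.finite_toSet) ?_).measure_zero _
    intro t ht
    simp only [Set.mem_ofPred_eq] at ht
    simp [hq0, hq, ht]
  -- Each line through `x₀` meets the zero set in finitely many points, so Fubini makes this set
  -- null. Fubini in the other order then yields some `t ≠ 0` whose slice is null, and that slice is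
  -- a scaled translate of the zero set.
  have hprod : (volume : Measure (ℝ × (σ → ℝ))) {q | eval (x₀ + q.1 • q.2) p = 0} = 0 := by
    rw [Measure.volume_eq_prod, ← Measure.prod_swap, Measure.map_apply measurable_swap hA,
      Measure.measure_prod_null (measurable_swap hA)]
    exact Filter.Eventually.of_forall hline
  rw [Measure.volume_eq_prod, Measure.measure_prod_null hA] at hprod
  obtain ⟨t, ht, ht0⟩ := (hprod.and (volume.ae_ne (0 : ℝ))).exists
  have h1 : volume ((fun x => t • x) ⁻¹' {y : σ → ℝ | eval (x₀ + y) p = 0}) = 0 := ht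
  rw [Measure.addHaar_preimage_smul _ ht0] at h1
  have h2 : volume {y : σ → ℝ | eval (x₀ + y) p = 0} = 0 := by
    refine (mul_eq_zero.1 h1).resolve_left ?_
    simpa [abs_pos] using pow_pos (abs_pos.2 ht0) _
  have h3 := measure_preimage_add (volume : Measure (σ → ℝ)) x₀ {y : σ → ℝ | eval y p = 0}
  rw [← h3]
  exact h2

/-- The coordinate hyperplane `x_i = 0`, together with the zero set of `p ≠ 0`, is a variety of
codimension one. -/
theorem algebraicDim_zeroLocus_mul_X {σ : Type*} [Fintype σ] {p : MvPolynomial σ ℝ} (hp : p ≠ 0)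
    (i : σ) :
    algebraicDim (zeroLocus ℝ (Ideal.span {p * X i})) + 1 = ((Fintype.card σ : ℕ) : WithBot ℕ∞) := by
  classical
  have hdim : ∀ (τ : Type _) [Fintype τ], ringKrullDim (MvPolynomial τ ℝ) =
      ((Fintype.card τ : ℕ) : WithBot ℕ∞) := by
    intro τ _
    rw [MvPolynomial.ringKrullDim_of_isNoetherianRing]
    simp
  set V := zeroLocus ℝ (Ideal.span {p * X i}) with hV
  apply le_antisymm
  -- Upper bound: `p * X i` is a non-zero-divisor that vanishes on `V`.
  · have hmem : Ideal.span {p * X i} ≤ vanishingIdeal ℝ V := le_vanishingIdeal_zeroLocus _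
    have hr : p * X i ∈ nonZeroDivisors (MvPolynomial σ ℝ) :=
      mem_nonZeroDivisors_of_ne_zero (mul_ne_zero hp (X_ne_zero i))
    calc algebraicDim V + 1
        ≤ ringKrullDim (MvPolynomial σ ℝ ⧸ Ideal.span {p * X i}) + 1 := by
          gcongr
          exact ringKrullDim_le_of_surjective (Ideal.Quotient.factor hmem)
            (Ideal.Quotient.factor_surjective hmem)
      _ ≤ _ := ringKrullDim_quotient_succ_le_of_nonZeroDivisor hr
      _ = _ := hdim σ
  -- Lower bound: `V` contains the hyperplane `x_i = 0`, so functions on `V` surject onto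
  -- polynomials in the other variables. The real zero set of `p` alone could have smaller
  -- dimension; this is why the factor `X i` is added.
  · let τ := {j : σ // j ≠ i}
    let φ : MvPolynomial σ ℝ →ₐ[ℝ] MvPolynomial τ ℝ :=
      aeval fun j => if h : j = i then 0 else X ⟨j, h⟩
    have hφ : ∀ q ∈ vanishingIdeal ℝ V, φ q = 0 := by
      intro q hq
      apply MvPolynomial.funext
      intro y
      let x : σ → ℝ := fun j => if h : j = i then 0 else y ⟨j, h⟩
      have hx : x ∈ V := by
        rw [hV, zeroLocus_span]
        simp [x]
      have h1 := (mem_vanishingIdeal_iff.1 hq) x hx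
      have : (aeval (R := ℝ) y).comp φ = aeval x := by
        ext j
        by_cases h : j = i <;> simp [φ, x, h]
      have h2 := DFunLike.congr_fun this q
      simp only [AlgHom.comp_apply] at h2
      rw [h1] at h2
      simpa [MvPolynomial.coe_aeval_eq_eval] using h2
    have hsurj : Function.Surjective φ := by
      rw [← AlgHom.range_eq_top, eq_top_iff, ← MvPolynomial.adjoin_range_X, Algebra.adjoin_le_iff]
      rintro _ ⟨j, rfl⟩
      exact ⟨X j.1, by simp [φ, j.2]⟩
    have h1 : ringKrullDim (MvPolynomial τ ℝ) ≤ algebraicDim V :=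
      ringKrullDim_le_of_surjective (Ideal.Quotient.lift _ (φ : _ →+* _) hφ)
        (Ideal.Quotient.lift_surjective_of_surjective _ _ hsurj)
    rw [hdim τ] at h1
    have hcard : Fintype.card σ = Fintype.card τ + 1 := by
      have := Fintype.card_subtype_compl (fun j => j = i)
      have h0 : 0 < Fintype.card σ := Fintype.card_pos_iff.2 ⟨i⟩
      simp only [Fintype.card_subtype_eq] at this
      have h2 : Fintype.card τ = Fintype.card σ - 1 := by
        rw [← this]
      omega
    rw [hcard]
    push_cast
    gcongr

end PolynomialZeros

/-! ### Shortening words and reduction to orthonormal frames -/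

section Frames

open Module

/-- If some non-empty word in the operators `g i` maps `u` to a vector on which `f` does not vanish,
then so does a non-empty word whose length is at most the dimension of the space. -/
theorem exists_word_length_le_finrank {U ι : Type*} [AddCommGroup U] [Module ℝ U]
    [FiniteDimensional ℝ U] (g : ι → Module.End ℝ U) (f : U →ₗ[ℝ] ℝ) (u : U) (w : List ι)
    (hw : w ≠ []) (h : f ((w.map g).prod u) ≠ 0) :
    ∃ w' : List ι, w' ≠ [] ∧ w'.length ≤ finrank ℝ U ∧ f ((w'.map g).prod u) ≠ 0 := by
  induction hn : w.length using Nat.strong_induction_on generalizing w with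
  | _ n ih =>
    by_cases hle : n ≤ finrank ℝ U
    · exact ⟨w, hw, hn ▸ hle, h⟩
    by_contra! hcon
    -- In a minimal word the suffixes applied to `u` are independent: pairing the prefix of length
    -- `r` with the suffix from `s` gives the full word if `r = s` and a strictly shorter one if `r
    -- < s`, so the matrix `T` is triangular with non-zero diagonal. The empty suffix is left out,
    -- which keeps the shortened words non-empty.
    let x : Fin n → U := fun s => ((w.drop s).map g).prod u
    let T : Matrix (Fin n) (Fin n) ℝ := fun r s => f (((w.take r).map g).prod (x s))
    have hT : ∀ r s, T r s = f (((w.take r ++ w.drop s).map g).prod u) := by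
      intro r s
      simp [T, x]
    have hdiag : ∀ r, T r r ≠ 0 := by
      intro r
      rw [hT, List.take_append_drop]
      exact h
    have htri : ∀ r s, r < s → T r s = 0 := by
      intro r s hrs
      by_contra hne
      rw [hT] at hne
      have hlen : (w.take r ++ w.drop s).length = r + (n - s) := by
        simp [hn]
      have hrs' : (r : ℕ) < s := hrs
      have hs := s.2
      obtain ⟨w', h1, h2, h3⟩ := ih (r + (n - s)) (by omega) _ (by
        intro h0
        rw [h0] at hlen
        simp at hlen
        omega) hne hlen
      exact h3 (hcon w' h1 h2)
    have hdet : T.det ≠ 0 := by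
      rw [Matrix.det_of_isLowerTriangular T (fun i j hij => htri i j hij)]
      exact Finset.prod_ne_zero_iff.2 fun i _ => hdiag i
    have hli : LinearIndependent ℝ x := by
      rw [Fintype.linearIndependent_iff]
      intro c hc
      have hmul : T.mulVec c = 0 := by
        ext r
        have := congrArg (fun y => f (((w.take r).map g).prod y)) hc
        simp only [map_sum, map_smul, map_zero, smul_eq_mul] at this
        simpa [Matrix.mulVec, dotProduct, T, mul_comm] using this
      have := Matrix.eq_zero_of_mulVec_eq_zero hdet hmul
      simp [this]
    have := hli.fintype_card_le_finrank
    simp at this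
    omega

/-- The matrix `(⟪S a_j, b_i⟫)` has this determinant. -/
def frameDet {d m : ℕ} (S : E d →ₗ[ℝ] E d) (a b : Fin m → E d) : ℝ :=
  Matrix.det (Matrix.of fun i j => inner ℝ (S (a j)) (b i))

theorem inner_map_ιMulti {d m : ℕ} (S : E d →ₗ[ℝ] E d) (a b : Fin m → E d) :
    inner ℝ (exteriorPower.map m S (exteriorPower.ιMulti ℝ m a)) (exteriorPower.ιMulti ℝ m b) =
      frameDet S a b := by
  rw [exteriorPower.map_apply_ιMulti, exteriorPower.inner_ιMulti_ιMulti]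
  rfl

theorem ιMulti_ne_zero_of_orthonormal {d m : ℕ} {a : Fin m → E d} (ha : Orthonormal ℝ a) :
    exteriorPower.ιMulti ℝ m a ≠ 0 := by
  intro h
  have h1 := exteriorPower.inner_ιMulti_self a
  rw [h, inner_zero_left, Matrix.gram_eq_one_iff_orthonormal.2 ha, Matrix.det_one] at h1
  exact zero_ne_one h1

theorem wedge_ιMulti {d m : ℕ} (a : Fin m → E d) (x : E d) :
    wedge (exteriorPower.ιMulti ℝ m a) x = exteriorPower.ιMulti ℝ (m + 1) (Fin.snoc a x) := by
  apply Subtype.ext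
  simp only [wedge, exteriorPower.ιMulti_apply_coe, ExteriorAlgebra.ιMulti_apply]
  rw [List.ofFn_succ']
  simp

theorem wedge_smul {d m : ℕ} (c : ℝ) (v : Ext d m) (x : E d) : wedge (c • v) x = c • wedge v x := by
  apply Subtype.ext
  simp [wedge]

/-- One Gram–Schmidt step: subtracting from `x` its projection to the span of `e` does not change
the wedge product, and normalising the remainder produces the scalar. -/
theorem exists_orthonormal_snoc {d m : ℕ} {e : Fin m → E d} (he : Orthonormal ℝ e) {x : E d}
    (hx : wedge (exteriorPower.ιMulti ℝ m e) x ≠ 0) :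
    ∃ (y : E d) (c : ℝ), c ≠ 0 ∧ Orthonormal ℝ (Fin.snoc e y : Fin (m + 1) → E d) ∧
      wedge (exteriorPower.ιMulti ℝ m e) x =
        c • exteriorPower.ιMulti ℝ (m + 1) (Fin.snoc e y : Fin (m + 1) → E d) := by
  rw [wedge_ιMulti] at hx ⊢
  let A := exteriorPower.ιMulti ℝ (M := E d) (m + 1)
  have hsnoc : ∀ y : E d, (Fin.snoc e y : Fin (m + 1) → E d) =
      Function.update (Fin.snoc e 0) (Fin.last m) y := by
    intro y
    rw [Fin.update_snoc_last]
  let L : E d →ₗ[ℝ] Ext d (m + 1) := A.toMultilinearMap.toLinearMap (Fin.snoc e 0) (Fin.last m)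
  have hL : ∀ y, A (Fin.snoc e y : Fin (m + 1) → E d) = L y := by
    intro y
    rw [hsnoc]
    rfl
  have hLe : ∀ i, L (e i) = 0 := by
    intro i
    rw [← hL]
    apply A.map_eq_zero_of_eq (i := i.castSucc) (j := Fin.last m)
    · simp
    · exact (Fin.castSucc_lt_last i).ne
  let r : E d := x - ∑ i, inner ℝ (e i) x • e i
  have hr : L r = L x := by simp [r, hLe]
  have hr0 : r ≠ 0 := by
    intro h0
    apply hx
    change A _ = 0
    rw [hL, ← hr, h0, map_zero]
  have horth : ∀ i, inner ℝ (e i) r = 0 := by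
    intro i
    simp only [r, inner_sub_right]
    rw [he.inner_right_fintype, sub_self]
  have hn : ‖r‖ ≠ 0 := norm_ne_zero_iff.2 hr0
  refine ⟨(‖r‖⁻¹ : ℝ) • r, ‖r‖, hn, ?_, ?_⟩
  · rw [orthonormal_iff_ite] at he ⊢
    intro i j
    refine Fin.lastCases ?_ (fun i => ?_) i
    · refine Fin.lastCases ?_ (fun j => ?_) j
      · simp [norm_smul, hn]
      · simp [inner_smul_left, real_inner_comm, horth, (Fin.castSucc_lt_last j).ne']
    · refine Fin.lastCases ?_ (fun j => ?_) j
      · simp [inner_smul_right, horth, (Fin.castSucc_lt_last i).ne]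
      · simp [he]
  · change A _ = ‖r‖ • A _
    rw [hL, hL, map_smul, smul_smul, mul_inv_cancel₀ hn, one_smul, hr]

theorem IsDecomposable.exists_orthonormal {d m : ℕ} {v : Ext d m} (hv : IsDecomposable v)
    (h0 : v ≠ 0) : ∃ (e : Fin m → E d) (c : ℝ), c ≠ 0 ∧ Orthonormal ℝ e ∧
      v = c • exteriorPower.ιMulti ℝ m e := by
  obtain ⟨a, rfl⟩ := hv
  induction m with
  | zero => exact ⟨a, 1, one_ne_zero, ⟨fun i => i.elim0, fun i => i.elim0⟩, by simp⟩
  | succ m ih =>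
    have ha : exteriorPower.ιMulti ℝ (m + 1) a =
        wedge (exteriorPower.ιMulti ℝ m (Fin.init a)) (a (Fin.last m)) := by
      rw [wedge_ιMulti, Fin.snoc_init_self]
    rw [ha] at h0 ⊢
    have h1 : exteriorPower.ιMulti ℝ m (Fin.init a) ≠ 0 := by
      intro h
      apply h0
      rw [h]
      apply Subtype.ext
      simp [wedge]
    obtain ⟨e, c, hc, he, hce⟩ := ih _ h1
    rw [hce, wedge_smul] at h0 ⊢
    obtain ⟨y, c', hc', hy, hcy⟩ := exists_orthonormal_snoc he (x := a (Fin.last m)) (by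
      intro h
      exact h0 (by rw [h, smul_zero]))
    exact ⟨_, c * c', mul_ne_zero hc hc', hy, by rw [hcy, smul_smul]⟩

theorem inner_smul_smul {d m : ℕ} (c c' : ℝ) (v w : Ext d m) :
    inner ℝ (c • v) (c' • w) = c * (c' * inner ℝ v w) :=
  (real_inner_smul_left v (c' • w) c).trans (congrArg (c * ·) (real_inner_smul_right v w c'))

/-- It suffices to test condition `C(m)` on orthonormal frames. -/
theorem conditionCNat_iff {d m : ℕ} (T : Set (E d →ₗ[ℝ] E d)) :
    ConditionCNat T m ↔ ∀ a b : Fin m → E d, Orthonormal ℝ a → Orthonormal ℝ b →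
      ∃ S ∈ T, frameDet S a b ≠ 0 := by
  constructor
  · intro h a b ha hb
    obtain ⟨S, hS, h1⟩ := h _ _ ⟨a, rfl⟩ ⟨b, rfl⟩ (ιMulti_ne_zero_of_orthonormal ha)
      (ιMulti_ne_zero_of_orthonormal hb)
    rw [inner_map_ιMulti] at h1
    exact ⟨S, hS, h1⟩
  · intro h v w hv hw hv0 hw0
    obtain ⟨a, c, hc, ha, rfl⟩ := hv.exists_orthonormal hv0
    obtain ⟨b, c', hc', hb, rfl⟩ := hw.exists_orthonormal hw0
    obtain ⟨S, hS, h1⟩ := h a b ha hb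
    refine ⟨S, hS, ?_⟩
    rw [map_smul, inner_smul_smul, inner_map_ιMulti]
    exact mul_ne_zero hc (mul_ne_zero hc' h1)

/-- It suffices to test condition `C(s)` for non-integral `s` on orthonormal frames. -/
theorem conditionCBetween_iff {d m : ℕ} (T : Set (E d →ₗ[ℝ] E d)) :
    ConditionCBetween T m ↔ ∀ a b : Fin (m + 1) → E d, Orthonormal ℝ a → Orthonormal ℝ b →
      ∃ S ∈ T, frameDet S (Fin.init a) (Fin.init b) ≠ 0 ∧ frameDet S a b ≠ 0 := by
  have hinit : ∀ a : Fin (m + 1) → E d, Orthonormal ℝ a → Orthonormal ℝ (Fin.init a) :=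
    fun a ha => ha.comp _ (Fin.castSucc_injective m)
  have hw : ∀ a : Fin (m + 1) → E d, wedge (exteriorPower.ιMulti ℝ m (Fin.init a)) (a (Fin.last m)) =
      exteriorPower.ιMulti ℝ (m + 1) a := by
    intro a
    rw [wedge_ιMulti, Fin.snoc_init_self]
  constructor
  · intro h a b ha hb
    obtain ⟨S, hS, h1, h2⟩ := h _ _ (a (Fin.last m)) (b (Fin.last m)) ⟨Fin.init a, rfl⟩
      ⟨Fin.init b, rfl⟩ (ιMulti_ne_zero_of_orthonormal (hinit a ha))
      (ιMulti_ne_zero_of_orthonormal (hinit b hb))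
      (by rw [hw]; exact ιMulti_ne_zero_of_orthonormal ha)
      (by rw [hw]; exact ιMulti_ne_zero_of_orthonormal hb)
    rw [hw, hw, inner_map_ιMulti] at h2
    rw [inner_map_ιMulti] at h1
    exact ⟨S, hS, h1, h2⟩
  · intro h v w x y hv hw hv0 hw0 hx hy
    obtain ⟨a, c, hc, ha, rfl⟩ := hv.exists_orthonormal hv0
    obtain ⟨b, c', hc', hb, rfl⟩ := hw.exists_orthonormal hw0
    rw [wedge_smul] at hx hy ⊢
    obtain ⟨x', γ, hγ, hx', hcx⟩ := exists_orthonormal_snoc ha (right_ne_zero_of_smul hx)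
    obtain ⟨y', γ', hγ', hy', hcy⟩ := exists_orthonormal_snoc hb (right_ne_zero_of_smul hy)
    obtain ⟨S, hS, h1, h2⟩ := h _ _ hx' hy'
    rw [Fin.init_snoc, Fin.init_snoc] at h1
    refine ⟨S, hS, ?_, ?_⟩
    · rw [map_smul, inner_smul_smul, inner_map_ιMulti]
      exact mul_ne_zero hc (mul_ne_zero hc' h1)
    · rw [wedge_smul, hcx, hcy, smul_smul, smul_smul, map_smul, inner_smul_smul, inner_map_ιMulti]
      exact mul_ne_zero (mul_ne_zero hc hγ) (mul_ne_zero (mul_ne_zero hc' hγ') h2)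

/-- The linear map that a word in the letters `1, …, k` defines. -/
def wordMap {d k : ℕ} (𝓕 : FamilySpace d k) (w : List (Fin k)) : Module.End ℝ (E d) :=
  (w.map fun i => (member 𝓕 i : Module.End ℝ (E d))).prod

theorem mem_compositions {d k l : ℕ} {𝓕 : FamilySpace d k} {T : E d →ₗ[ℝ] E d} :
    T ∈ compositions l 𝓕 ↔ ∃ w : List (Fin k), w ≠ [] ∧ w.length ≤ l ∧ T = wordMap 𝓕 w := by
  constructor
  · rintro ⟨j, h1, h2, i, rfl⟩
    refine ⟨List.ofFn i, ?_, by simpa using h2, ?_⟩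
    · rw [← List.length_pos_iff_ne_nil]
      simpa using Nat.succ_le_iff.1 h1
    · rw [wordMap, List.map_ofFn]
      rfl
  · rintro ⟨w, h1, h2, rfl⟩
    refine ⟨w.length, List.length_pos_iff_ne_nil.2 h1, h2, w.get, ?_⟩
    rw [wordMap, ← List.ofFn_get (w.map _)]
    simp [List.ofFn_getElem_eq_map]

/-- All `s` strictly between `m` and `m + 1` give the same condition, represented by `m + 1 / 2`;
only finitely many conditions remain. -/
theorem mem_typicalSet_iff {d k : ℕ} {𝓕 : FamilySpace d k} :
    𝓕 ∈ typicalSet d k ↔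
      (∀ m ≤ d, ConditionCNat (compositions (2 * n₀ d ^ 2) 𝓕) m) ∧
        ∀ m < d, ConditionCBetween (compositions (2 * n₀ d ^ 2) 𝓕) m := by
  constructor
  · intro h
    refine ⟨fun m hm => (h m (Nat.cast_nonneg m) (by exact_mod_cast hm)).1 m rfl, fun m hm => ?_⟩
    have hm' : (m : ℝ) + 1 ≤ d := by exact_mod_cast hm
    exact (h (m + 1 / 2) (by positivity) (by linarith)).2 m (by linarith) (by linarith)
  · rintro ⟨h1, h2⟩ s - hs
    refine ⟨fun m hm => h1 m ?_, fun m hm _ => h2 m ?_⟩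
    · rw [hm] at hs
      exact_mod_cast hs
    · exact_mod_cast hm.trans_le hs

theorem choose_le_n₀ {d m : ℕ} (hm : m ≤ d) : d.choose m ≤ n₀ d :=
  Finset.le_sup (f := fun m => d.choose m) (Finset.mem_range.2 (by omega))

theorem n₀_pos (d : ℕ) : 0 < n₀ d :=
  lt_of_lt_of_le (by simp) (choose_le_n₀ (Nat.zero_le d))

theorem exteriorPower_map_wordMap {d k m : ℕ} (𝓕 : FamilySpace d k) (w : List (Fin k)) :
    exteriorPower.map m (wordMap 𝓕 w : E d →ₗ[ℝ] E d) =
      (w.map fun i => (exteriorPower.map m (member 𝓕 i) : Module.End ℝ (Ext d m))).prod := by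
  induction w with
  | nil => exact exteriorPower.map_id (R := ℝ) (M := E d) (n := m)
  | cons i w ih =>
    rw [List.map_cons, List.prod_cons, ← ih]
    exact exteriorPower.map_comp _ _

/-- Condition `C(s)` for all `s` follows if, for orthonormal frames, words of arbitrary length can be
used. -/
theorem mem_typicalSet_of_words {d k : ℕ} {𝓕 : FamilySpace d k}
    (h1 : ∀ m ≤ d, ∀ a b : Fin m → E d, Orthonormal ℝ a → Orthonormal ℝ b →
      ∃ w ≠ [], frameDet (wordMap 𝓕 w) a b ≠ 0)
    (h2 : ∀ m < d, ∀ a b : Fin (m + 1) → E d, Orthonormal ℝ a → Orthonormal ℝ b →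
      ∃ w ≠ [], frameDet (wordMap 𝓕 w) (Fin.init a) (Fin.init b) ≠ 0 ∧
        frameDet (wordMap 𝓕 w) a b ≠ 0) :
    𝓕 ∈ typicalSet d k := by
  rw [mem_typicalSet_iff]
  have hpos := n₀_pos d
  constructor
  · intro m hm
    rw [conditionCNat_iff]
    intro a b ha hb
    obtain ⟨w, hw, hne⟩ := h1 m hm a b ha hb
    rw [← inner_map_ιMulti, exteriorPower_map_wordMap, real_inner_comm] at hne
    obtain ⟨w', hw', hl, hne'⟩ := exists_word_length_le_finrank _
      (innerₗ (Ext d m) (exteriorPower.ιMulti ℝ m b)) _ w hw hne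
    refine ⟨_, mem_compositions.2 ⟨w', hw', hl.trans ?_, rfl⟩, ?_⟩
    · rw [exteriorPower.finrank_eq, finrank_euclideanSpace_fin]
      nlinarith [choose_le_n₀ hm]
    · rw [← inner_map_ιMulti, exteriorPower_map_wordMap, real_inner_comm]
      exact hne'
  · intro m hm
    rw [conditionCBetween_iff]
    intro a b ha hb
    obtain ⟨w, hw, hne, hne2⟩ := h2 m hm a b ha hb
    -- One word must serve both determinants. On the tensor product, `f` takes their product as its
    -- value, so the shortening lemma applies to both at once. The dimension there is at most `n₀ d
    -- ^ 2`.
    let g : Fin k → Module.End ℝ (TensorProduct ℝ (Ext d m) (Ext d (m + 1))) := fun i =>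
      TensorProduct.map (exteriorPower.map m (member 𝓕 i)) (exteriorPower.map (m + 1) (member 𝓕 i))
    let f : TensorProduct ℝ (Ext d m) (Ext d (m + 1)) →ₗ[ℝ] ℝ :=
      LinearMap.mul' ℝ ℝ ∘ₗ TensorProduct.map
        (innerₗ (Ext d m) (exteriorPower.ιMulti ℝ m (Fin.init b)))
        (innerₗ (Ext d (m + 1)) (exteriorPower.ιMulti ℝ (m + 1) b))
    have hg : ∀ w : List (Fin k), (w.map g).prod =
        TensorProduct.map (exteriorPower.map m (wordMap 𝓕 w : E d →ₗ[ℝ] E d))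
          (exteriorPower.map (m + 1) (wordMap 𝓕 w : E d →ₗ[ℝ] E d)) := by
      intro w
      rw [exteriorPower_map_wordMap, exteriorPower_map_wordMap]
      induction w with
      | nil => exact TensorProduct.map_id.symm
      | cons i w ih =>
        rw [List.map_cons, List.prod_cons, ih]
        exact (TensorProduct.map_comp _ _ _ _).symm
    have hf : ∀ w : List (Fin k), f ((w.map g).prod
        (exteriorPower.ιMulti ℝ m (Fin.init a) ⊗ₜ exteriorPower.ιMulti ℝ (m + 1) a)) =
        frameDet (wordMap 𝓕 w) (Fin.init a) (Fin.init b) * frameDet (wordMap 𝓕 w) a b := by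
      intro w
      rw [hg, ← inner_map_ιMulti, ← inner_map_ιMulti]
      simp only [f, LinearMap.comp_apply, TensorProduct.map_tmul, LinearMap.mul'_apply,
        innerₗ_apply_apply]
      rw [real_inner_comm, real_inner_comm (exteriorPower.ιMulti ℝ (m + 1) b)]
    obtain ⟨w', hw', hl, hne'⟩ := exists_word_length_le_finrank
      (U := TensorProduct ℝ (Ext d m) (Ext d (m + 1))) g f
      (exteriorPower.ιMulti ℝ m (Fin.init a) ⊗ₜ exteriorPower.ιMulti ℝ (m + 1) a) w hw
      (by rw [hf]; exact mul_ne_zero hne hne2)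
    rw [hf] at hne'
    refine ⟨_, mem_compositions.2 ⟨w', hw', hl.trans ?_, rfl⟩, left_ne_zero_of_mul hne',
      right_ne_zero_of_mul hne'⟩
    rw [Module.finrank_tensorProduct, exteriorPower.finrank_eq, exteriorPower.finrank_eq,
      finrank_euclideanSpace_fin]
    nlinarith [choose_le_n₀ hm.le, choose_le_n₀ (Nat.succ_le_of_lt hm),
      Nat.mul_le_mul (choose_le_n₀ hm.le) (choose_le_n₀ (Nat.succ_le_of_lt hm))]

end Frames

/-! ### Openness by compactness of the set of frames -/

section Openness

open Filter Topology

theorem continuous_wordMap_apply {X : Type*} [TopologicalSpace X] {d k : ℕ} (w : List (Fin k))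
    {F : X → FamilySpace d k} {y : X → E d} (hF : Continuous F) (hy : Continuous y) :
    Continuous fun p => wordMap (F p) w (y p) := by
  induction w with
  | nil => simpa [wordMap] using hy
  | cons i w ih =>
    have h : ∀ p, wordMap (F p) (i :: w) (y p) = member (F p) i (wordMap (F p) w (y p)) :=
      fun p => rfl
    simp only [h, member, Matrix.toLpLin_apply]
    refine (PiLp.continuous_toLp 2 _).comp (Continuous.matrix_mulVec ?_ ?_)
    · exact continuous_matrix fun a b => (continuous_apply (i, a, b)).comp hF
    · exact (PiLp.continuous_ofLp 2 _).comp ih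

theorem continuous_frameDet_wordMap {X : Type*} [TopologicalSpace X] {d k m : ℕ} (w : List (Fin k))
    {F : X → FamilySpace d k} {a b : X → Fin m → E d} (hF : Continuous F) (ha : Continuous a)
    (hb : Continuous b) : Continuous fun p => frameDet (wordMap (F p) w) (a p) (b p) := by
  refine Continuous.matrix_det (continuous_matrix fun i j => ?_)
  exact (continuous_wordMap_apply w hF ((continuous_apply j).comp ha)).inner
    ((continuous_apply i).comp hb)

theorem isCompact_orthonormal (d m : ℕ) : IsCompact {a : Fin m → E d | Orthonormal ℝ a} := by
  apply Metric.isCompact_of_isClosed_isBounded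
  · simp only [orthonormal_iff_ite, Set.ofPred_forall]
    refine isClosed_iInter fun i => isClosed_iInter fun j => isClosed_eq ?_ continuous_const
    fun_prop
  · refine (Metric.isBounded_closedBall (x := (0 : Fin m → E d)) (r := 1)).subset ?_
    intro a ha
    rw [mem_closedBall_zero_iff, pi_norm_le_iff_of_nonneg zero_le_one]
    exact fun i => (ha.1 i).le

/-- A condition requiring, for all points of a compact set, that one of a collection of continuous
functions does not vanish, is open. -/
theorem isOpen_forall_exists_ne_zero {X Y ι : Type*} [TopologicalSpace X] [TopologicalSpace Y]
    {K : Set Y} (hK : IsCompact K) (s : Set ι) (f : ι → X → Y → ℝ)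
    (hf : ∀ i, Continuous fun p : X × Y => f i p.1 p.2) :
    IsOpen {x | ∀ y ∈ K, ∃ i ∈ s, f i x y ≠ 0} := by
  rw [isOpen_iff_eventually]
  intro x hx
  apply hK.eventually_forall_of_forall_eventually
  intro y hy
  obtain ⟨i, hi, hne⟩ := hx y hy
  filter_upwards [(hf i).continuousAt.eventually_ne (show f i (x, y).1 (x, y).2 ≠ 0 from hne)]
    with z hz using ⟨i, hi, hz⟩

theorem isOpen_typicalSet (d k : ℕ) : IsOpen (typicalSet d k) := by
  have h : typicalSet d k =
      (⋂ m ∈ Set.Iic d, {𝓕 | ConditionCNat (compositions (2 * n₀ d ^ 2) 𝓕) m}) ∩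
        ⋂ m ∈ Set.Iio d, {𝓕 | ConditionCBetween (compositions (2 * n₀ d ^ 2) 𝓕) m} := by
    ext 𝓕
    simp [mem_typicalSet_iff]
  have hK : ∀ m, IsCompact
      ({a : Fin m → E d | Orthonormal ℝ a} ×ˢ {b : Fin m → E d | Orthonormal ℝ b}) :=
    fun m => (isCompact_orthonormal d m).prod (isCompact_orthonormal d m)
  let s : Set (List (Fin k)) := {w | w ≠ [] ∧ w.length ≤ 2 * n₀ d ^ 2}
  rw [h]
  refine IsOpen.inter ((Set.finite_Iic d).isOpen_biInter fun m _ => ?_)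
    ((Set.finite_Iio d).isOpen_biInter fun m _ => ?_)
  · convert isOpen_forall_exists_ne_zero (hK m) s
      (fun w (𝓕 : FamilySpace d k) p => frameDet (wordMap 𝓕 w) p.1 p.2)
      (fun w => continuous_frameDet_wordMap w (by fun_prop) (by fun_prop) (by fun_prop)) using 1
    ext 𝓕
    simp only [Set.mem_ofPred_eq, conditionCNat_iff, mem_compositions, s]
    constructor
    · rintro h ⟨a, b⟩ ⟨ha, hb⟩
      obtain ⟨_, ⟨w, h1, h2, rfl⟩, h3⟩ := h a b ha hb
      exact ⟨w, ⟨h1, h2⟩, h3⟩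
    · intro h a b ha hb
      obtain ⟨w, ⟨h1, h2⟩, h3⟩ := h (a, b) ⟨ha, hb⟩
      exact ⟨_, ⟨w, h1, h2, rfl⟩, h3⟩
  · have hinit : Continuous fun a : Fin (m + 1) → E d => (Fin.init a : Fin m → E d) :=
      continuous_pi fun i => continuous_apply i.castSucc
    convert isOpen_forall_exists_ne_zero (hK (m + 1)) s
      (fun w (𝓕 : FamilySpace d k) p => frameDet (wordMap 𝓕 w) (Fin.init p.1) (Fin.init p.2) *
        frameDet (wordMap 𝓕 w) p.1 p.2)
      (fun w => (continuous_frameDet_wordMap w (by fun_prop) (hinit.comp (by fun_prop))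
        (hinit.comp (by fun_prop))).mul
          (continuous_frameDet_wordMap w (by fun_prop) (by fun_prop) (by fun_prop))) using 1
    ext 𝓕
    simp only [Set.mem_ofPred_eq, conditionCBetween_iff, mem_compositions, s]
    constructor
    · rintro h ⟨a, b⟩ ⟨ha, hb⟩
      obtain ⟨_, ⟨w, h1, h2, rfl⟩, h3, h4⟩ := h a b ha hb
      exact ⟨w, ⟨h1, h2⟩, mul_ne_zero h3 h4⟩
    · intro h a b ha hb
      obtain ⟨w, ⟨h1, h2⟩, h3⟩ := h (a, b) ⟨ha, hb⟩
      exact ⟨_, ⟨w, h1, h2, rfl⟩, left_ne_zero_of_mul h3, right_ne_zero_of_mul h3⟩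

end Openness

/-! ### A Zariski dense matrix semigroup -/

section Density

open Matrix

section MatrixPolynomials

open MvPolynomial

variable {n : Type*} [Fintype n]

/-- The value at the matrix `M` of a polynomial in the matrix entries. -/
def evalMatrix (M : Matrix n n ℝ) (P : MvPolynomial (n × n) ℝ) : ℝ := eval (fun q => M q.1 q.2) P

/-- The Zariski closure of a set of matrices. -/
def zariskiClosure (S : Set (Matrix n n ℝ)) : Set (Matrix n n ℝ) :=
  {M | ∀ P : MvPolynomial (n × n) ℝ, (∀ N ∈ S, evalMatrix N P = 0) → evalMatrix M P = 0}

theorem exists_evalMatrix_mul_right (N : Matrix n n ℝ) (P : MvPolynomial (n × n) ℝ) :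
    ∃ Q : MvPolynomial (n × n) ℝ, ∀ M, evalMatrix M Q = evalMatrix (M * N) P := by
  refine ⟨aeval (fun q => ∑ l, X (q.1, l) * C (N l q.2)) P, fun M => ?_⟩
  have : (aeval (R := ℝ) fun q : n × n => M q.1 q.2).comp
      (aeval fun q : n × n => ∑ l, X (q.1, l) * C (N l q.2)) =
      aeval fun q : n × n => (M * N) q.1 q.2 := by
    ext q
    simp [Matrix.mul_apply]
  exact DFunLike.congr_fun this P

theorem exists_evalMatrix_mul_left (N : Matrix n n ℝ) (P : MvPolynomial (n × n) ℝ) :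
    ∃ Q : MvPolynomial (n × n) ℝ, ∀ M, evalMatrix M Q = evalMatrix (N * M) P := by
  refine ⟨aeval (fun q => ∑ l, C (N q.1 l) * X (l, q.2)) P, fun M => ?_⟩
  have : (aeval (R := ℝ) fun q : n × n => M q.1 q.2).comp
      (aeval fun q : n × n => ∑ l, C (N q.1 l) * X (l, q.2)) =
      aeval fun q : n × n => (N * M) q.1 q.2 := by
    ext q
    simp [Matrix.mul_apply]
  exact DFunLike.congr_fun this P

/-- The Zariski closure of a semigroup of matrices is closed under products. -/
theorem mul_mem_zariskiClosure (S : Subsemigroup (Matrix n n ℝ)) {M N : Matrix n n ℝ}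
    (hM : M ∈ zariskiClosure (S : Set (Matrix n n ℝ)))
    (hN : N ∈ zariskiClosure (S : Set (Matrix n n ℝ))) :
    M * N ∈ zariskiClosure (S : Set (Matrix n n ℝ)) := by
  intro P hP
  obtain ⟨Q, hQ⟩ := exists_evalMatrix_mul_left M P
  rw [← hQ]
  -- Membership is used one factor at a time: first the right factor is moved into `S` with `M`
  -- fixed, then the left one.
  refine hN Q fun N' hN' => ?_
  rw [hQ]
  obtain ⟨R, hR⟩ := exists_evalMatrix_mul_right N' P
  rw [← hR]
  refine hM R fun M' hM' => ?_
  rw [hR]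
  exact hP _ (S.mul_mem hM' hN')

/-- The restriction of a polynomial in the matrix entries to the line `t ↦ M * (1 + t • Y)`. -/
def alongLine (M Y : Matrix n n ℝ) : MvPolynomial (n × n) ℝ →ₐ[ℝ] Polynomial ℝ :=
  aeval fun q => Polynomial.C (M q.1 q.2) + Polynomial.X * Polynomial.C ((M * Y) q.1 q.2)

/-- The left-invariant vector field with value `Y` at the identity, as a linear function of `Y`. -/
def leftInvariant : Matrix n n ℝ →ₗ[ℝ] Derivation ℝ (MvPolynomial (n × n) ℝ) (MvPolynomial (n × n) ℝ)
    where
  toFun Y := mkDerivation ℝ fun q => ∑ l, C (Y l q.2) * X (q.1, l)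
  map_add' Y Z := by
    apply MvPolynomial.derivation_ext
    intro q
    simp [mkDerivation_X, add_mul, Finset.sum_add_distrib]
  map_smul' c Y := by
    apply MvPolynomial.derivation_ext
    intro q
    simp [mkDerivation_X, Finset.smul_sum, MvPolynomial.smul_eq_C_mul, mul_assoc]

/-- The velocity of the line is `M * Y`, while the vector field at `M * (1 + t • Y)` is `M * (1 + t
• Y) * Y`; they agree because `Y * Y = 0`. -/
theorem derivative_alongLine {M Y : Matrix n n ℝ} (hY : Y * Y = 0) (P : MvPolynomial (n × n) ℝ) :
    Polynomial.derivative (alongLine M Y P) = alongLine M Y (leftInvariant Y P) := by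
  have hX : ∀ q : n × n, Polynomial.derivative (alongLine M Y (X q)) =
      alongLine M Y (leftInvariant Y (X q)) := by
    intro q
    have h1 : ∑ l, (M * Y) q.1 l * Y l q.2 = 0 := by
      rw [← Matrix.mul_apply, Matrix.mul_assoc, hY, Matrix.mul_zero]
      rfl
    have h2 : ∑ l, Polynomial.C (Y l q.2) *
        (Polynomial.C (M q.1 l) + Polynomial.X * Polynomial.C ((M * Y) q.1 l)) =
        Polynomial.C (∑ l, M q.1 l * Y l q.2) +
          Polynomial.X * Polynomial.C (∑ l, (M * Y) q.1 l * Y l q.2) := by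
      simp only [map_sum, map_mul, Finset.mul_sum, ← Finset.sum_add_distrib]
      exact Finset.sum_congr rfl fun l _ => by ring
    simp only [leftInvariant, LinearMap.coe_mk, AddHom.coe_mk, mkDerivation_X, map_sum, map_mul]
    simp only [alongLine, aeval_X, algHom_C, Polynomial.algebraMap_eq, h2, h1]
    simp [Matrix.mul_apply]
  induction P using MvPolynomial.induction_on with
  | C a => simp [alongLine]
  | add P Q hP hQ => simp [hP, hQ]
  | mul_X P q hP =>
    rw [Derivation.leibniz, map_mul, Polynomial.derivative_mul, hP, hX]
    simp
    ring

variable [DecidableEq n]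

theorem eval_alongLine (M Y : Matrix n n ℝ) (t : ℝ) (P : MvPolynomial (n × n) ℝ) :
    (alongLine M Y P).eval t = evalMatrix (M * (1 + t • Y)) P := by
  have : (Polynomial.aeval t).comp (alongLine M Y) =
      aeval (R := ℝ) fun q : n × n => (M * (1 + t • Y)) q.1 q.2 := by
    ext q
    simp [alongLine, mul_add]
    ring
  exact DFunLike.congr_fun this P

/-- The vector fields preserving the polynomials that vanish on `S`. -/
def tangent (S : Set (Matrix n n ℝ)) : Submodule ℝ (Matrix n n ℝ) where
  carrier := {Y | ∀ P : MvPolynomial (n × n) ℝ, (∀ N ∈ S, evalMatrix N P = 0) →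
    ∀ N ∈ S, evalMatrix N (leftInvariant Y P) = 0}
  add_mem' {Y Z} hY hZ P hP N hN := by
    have h1 := hY P hP N hN
    have h2 := hZ P hP N hN
    simp only [evalMatrix] at h1 h2
    simp [evalMatrix, h1, h2]
  zero_mem' P hP N hN := by simp [evalMatrix]
  smul_mem' c Y hY P hP N hN := by
    have h1 := hY P hP N hN
    simp only [evalMatrix] at h1
    simp [evalMatrix, h1, MvPolynomial.smul_eval]

/-- Together with the converse `one_add_smul_mem_zariskiClosure`, this passes from unipotent
one-parameter groups to a linear space, in which linear combinations of different `Y` can be formed.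
-/
theorem mem_tangent (S : Subsemigroup (Matrix n n ℝ)) {Y : Matrix n n ℝ} (hY : Y * Y = 0)
    (h : ∀ t : ℝ, 1 + t • Y ∈ zariskiClosure (S : Set (Matrix n n ℝ))) :
    Y ∈ tangent (S : Set (Matrix n n ℝ)) := by
  intro P hP N hN
  have h0 : alongLine N Y P = 0 := by
    apply Polynomial.funext
    intro t
    rw [eval_alongLine, Polynomial.eval_zero]
    exact mul_mem_zariskiClosure S (fun Q hQ => hQ N hN) (h t) P hP
  have h1 := derivative_alongLine (M := N) hY P
  rw [h0, Polynomial.derivative_zero] at h1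
  have h2 := eval_alongLine N Y 0 (leftInvariant Y P)
  rw [← h1] at h2
  simpa using h2.symm

/-- The Taylor coefficients of `P` along the line at `1` are, up to factorials, values at `1` of
iterated derivatives of `P` along the vector field. These still vanish on `S`, hence at `1`. -/
theorem one_add_smul_mem_zariskiClosure {S : Set (Matrix n n ℝ)} {Y : Matrix n n ℝ}
    (hY : Y * Y = 0) (hone : 1 ∈ zariskiClosure S) (h : Y ∈ tangent S) (t : ℝ) :
    1 + t • Y ∈ zariskiClosure S := by
  intro P hP
  have h0 : ∀ (j : ℕ) (P : MvPolynomial (n × n) ℝ), (∀ N ∈ S, evalMatrix N P = 0) →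
      (alongLine 1 Y P).coeff j = 0 := by
    intro j
    induction j with
    | zero =>
      intro P hP
      rw [Polynomial.coeff_zero_eq_eval_zero, eval_alongLine]
      simpa using hone P hP
    | succ j ih =>
      intro P hP
      have h1 := ih _ (h P hP)
      rw [← derivative_alongLine hY, Polynomial.coeff_derivative] at h1
      exact (mul_eq_zero.1 h1).resolve_right (by positivity)
  have h1 : alongLine 1 Y P = 0 := Polynomial.ext fun j => by simp [h0 j P hP]
  have h2 := eval_alongLine 1 Y t P
  rw [h1] at h2
  simpa using h2.symm

/-- A polynomial that vanishes at the points `(a_i ^ j)_i`, `j ≥ 1`, is zero if the monomials take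
distinct values at `a`. -/
theorem eq_zero_of_eval_pow_eq_zero {σ : Type*} [Fintype σ] {a : σ → ℝ} (ha : ∀ i, a i ≠ 0)
    (hinj : Function.Injective fun α : σ →₀ ℕ => ∏ i, a i ^ α i) {Q : MvPolynomial σ ℝ}
    (hQ : ∀ j : ℕ, eval (fun i => a i ^ (j + 1)) Q = 0) : Q = 0 := by
  -- Distinct monomials give distinct characters `j ↦ (a ^ α) ^ j`, which are linearly independent
  -- by Dedekind. As the exponents start at `1`, each coefficient of the relation carries an extra
  -- factor `a ^ α`, which is non-zero.
  let χ : (σ →₀ ℕ) → (Multiplicative ℕ →* ℝ) := fun α => powersHom ℝ (∏ i, a i ^ α i)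
  have hχ : Function.Injective χ := (powersHom ℝ).injective.comp hinj
  have hli := (linearIndependent_monoidHom (Multiplicative ℕ) ℝ).comp χ hχ
  rw [linearIndependent_iff'] at hli
  have hsum := hli Q.support (fun α => coeff α Q * ∏ i, a i ^ α i) (by
    ext j
    have h := hQ (Multiplicative.toAdd j)
    rw [MvPolynomial.eval_eq'] at h
    simp only [Finset.sum_apply, Pi.smul_apply, smul_eq_mul, Pi.zero_apply, Function.comp]
    rw [← h]
    refine Finset.sum_congr rfl fun α _ => ?_
    simp only [χ, powersHom_apply, mul_assoc]
    congr 1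
    rw [← pow_succ', ← Finset.prod_pow]
    exact Finset.prod_congr rfl fun i _ => by rw [← pow_mul, ← pow_mul, mul_comm])
  by_contra hne
  obtain ⟨α, hα⟩ := MvPolynomial.support_nonempty.2 hne
  exact mul_ne_zero (mem_support_iff.1 hα)
    (Finset.prod_ne_zero_iff.2 fun i _ => pow_ne_zero _ (ha i)) (hsum α hα)

theorem diagonal_mem_zariskiClosure {S : Set (Matrix n n ℝ)} {a : n → ℝ} (ha : ∀ i, a i ≠ 0)
    (hinj : Function.Injective fun α : n →₀ ℕ => ∏ i, a i ^ α i)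
    (hS : ∀ j : ℕ, diagonal a ^ (j + 1) ∈ S) (x : n → ℝ) : diagonal x ∈ zariskiClosure S := by
  intro P hP
  let Q : MvPolynomial n ℝ := aeval (fun q : n × n => if q.1 = q.2 then X q.1 else 0) P
  have hQ : ∀ y, eval y Q = evalMatrix (diagonal y) P := by
    intro y
    have : (aeval (R := ℝ) y).comp
        (aeval fun q : n × n => if q.1 = q.2 then (X q.1 : MvPolynomial n ℝ) else 0) =
        aeval fun q : n × n => diagonal y q.1 q.2 := by
      ext q
      by_cases h : q.1 = q.2 <;> simp [h, diagonal_apply]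
    exact DFunLike.congr_fun this P
  have h0 : Q = 0 := eq_zero_of_eval_pow_eq_zero ha hinj fun j => by
    rw [hQ]
    have := hP _ (hS j)
    rwa [diagonal_pow] at this
  rw [← hQ, h0, map_zero]

theorem one_add_smul_mem_zariskiClosure_of_pow {S : Set (Matrix n n ℝ)} {Y : Matrix n n ℝ}
    (hY : Y * Y = 0) (hS : ∀ j : ℕ, (1 + Y) ^ (j + 1) ∈ S) (t : ℝ) :
    1 + t • Y ∈ zariskiClosure S := by
  have hpow : ∀ j : ℕ, (1 + Y) ^ j = 1 + (j : ℝ) • Y := by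
    intro j
    induction j with
    | zero => simp
    | succ j ih =>
      rw [pow_succ, ih, add_mul, one_mul, mul_add, mul_one, smul_mul_assoc, hY]
      push_cast
      rw [add_smul, one_smul, smul_zero]
      abel
  intro P hP
  -- Since `(1 + Y) ^ j = 1 + j • Y`, the restriction of `P` to the line vanishes at every positive
  -- integer.
  have h0 : alongLine 1 Y P = 0 := by
    apply Polynomial.eq_zero_of_infinite_isRoot
    refine (Set.infinite_range_of_injective
      (f := fun j : ℕ => ((j + 1 : ℕ) : ℝ)) fun i j h => by simpa using h).mono ?_
    rintro _ ⟨j, rfl⟩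
    change Polynomial.eval _ _ = 0
    rw [eval_alongLine, one_mul, ← hpow]
    exact hP _ (hS j)
  have h1 := eval_alongLine 1 Y t P
  rw [h0] at h1
  simpa using h1.symm

/-- The span of the conjugates of a matrix by diagonal matrices contains the matrix units at the
positions of its non-zero off-diagonal entries. -/
theorem single_mem_of_conj_diagonal_mem (L : Submodule ℝ (Matrix n n ℝ)) {Y : Matrix n n ℝ}
    (hL : ∀ t : n → ℝ, (∀ i, t i ≠ 0) → diagonal t * Y * diagonal t⁻¹ ∈ L) {i j : n} (hij : i ≠ j)
    (hY : Y i j ≠ 0) : Matrix.single i j (1 : ℝ) ∈ L := by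
  let f : ℝ → ℝ → n → ℝ := fun x y l => if l = i then x else if l = j then y else 1
  let c : ℝ → ℝ → Matrix n n ℝ := fun x y => diagonal (f x y) * Y * diagonal (f x y)⁻¹
  have hc : ∀ x y : ℝ, x ≠ 0 → y ≠ 0 → c x y ∈ L := by
    intro x y hx hy
    refine hL _ fun l => ?_
    simp only [f]
    split_ifs <;> simp [hx, hy]
  -- Conjugation multiplies entry `(k, l)` by `f k / f l`. Alternating over the signs of `x` and `y`
  -- leaves only `(i, j)` and `(j, i)`, with factors `4 * x / y` and `4 * y / x`: `8` and `2` at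
  -- `(2, 1)`, `4` and `4` at `(1, 1)`. Twice the first minus the second is `12` and `0`.
  have hsum : (12 * Y i j) • Matrix.single i j (1 : ℝ) =
      (2 : ℝ) • (c 2 1 - c (-2) 1 - c 2 (-1) + c (-2) (-1)) -
        (c 1 1 - c (-1) 1 - c 1 (-1) + c (-1) (-1)) := by
    ext k l
    simp only [c, Matrix.sub_apply, Matrix.add_apply, Matrix.smul_apply, mul_diagonal, diagonal_mul,
      Pi.inv_apply, f, smul_eq_mul, Matrix.single_apply]
    by_cases hki : k = i
    · by_cases hlj : l = j
      · subst hki hlj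
        simp [hij.symm]
        ring
      · by_cases hli : l = i
        · subst hki hli
          simp [hij.symm]
        · simp [hki, hli, hlj, Ne.symm hlj]
    · by_cases hkj : k = j
      · by_cases hli : l = i
        · subst hkj hli
          simp [hij.symm, hij]
          ring
        · by_cases hlj : l = j
          · subst hkj hlj
            simp [hij.symm, hij]
          · simp [hkj, hij, hij.symm, hli, hlj]
      · by_cases hli : l = i
        · simp [hki, Ne.symm hki, hkj, hli]
        · by_cases hlj : l = j
          · simp [hki, Ne.symm hki, hkj, hlj, hij.symm]
          · simp [hki, Ne.symm hki, hkj, hli, hlj]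
  have hmem : (12 * Y i j) • Matrix.single i j (1 : ℝ) ∈ L := by
    rw [hsum]
    refine L.sub_mem (L.smul_mem _ (L.add_mem (L.sub_mem (L.sub_mem ?_ ?_) ?_) ?_))
      (L.add_mem (L.sub_mem (L.sub_mem ?_ ?_) ?_) ?_) <;> apply hc <;> norm_num
  have h2 := L.smul_mem (12 * Y i j)⁻¹ hmem
  rwa [smul_smul, inv_mul_cancel₀ (by simpa using hY), one_smul] at h2

/-- A semigroup of matrices that contains a generic diagonal matrix and a generic unipotent matrix
`1 + Y` with `Y² = 0` is Zariski dense. -/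
theorem eq_zero_of_forall_evalMatrix_eq_zero (S : Subsemigroup (Matrix n n ℝ)) {a : n → ℝ}
    (ha : ∀ i, a i ≠ 0) (hinj : Function.Injective fun α : n →₀ ℕ => ∏ i, a i ^ α i)
    {Y : Matrix n n ℝ} (hY : Y * Y = 0) (hY0 : ∀ i j, i ≠ j → Y i j ≠ 0) (haS : diagonal a ∈ S)
    (hYS : 1 + Y ∈ S) {P : MvPolynomial (n × n) ℝ} (hP : ∀ M ∈ S, evalMatrix M P = 0) : P = 0 := by
  have hpow : ∀ M ∈ S, ∀ j : ℕ, M ^ (j + 1) ∈ S := by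
    intro M hM j
    induction j with
    | zero => simpa using hM
    | succ j ih => exact pow_succ M (j + 1) ▸ S.mul_mem ih hM
  have hdiag := diagonal_mem_zariskiClosure (S := (S : Set (Matrix n n ℝ))) ha hinj
    (hpow _ haS)
  have hYt := one_add_smul_mem_zariskiClosure_of_pow (S := (S : Set (Matrix n n ℝ))) hY
    (hpow _ hYS)
  have hone : (1 : Matrix n n ℝ) ∈ zariskiClosure (S : Set (Matrix n n ℝ)) := by
    simpa using hYt 0
  have hL : ∀ t : n → ℝ, (∀ i, t i ≠ 0) →
      diagonal t * Y * diagonal t⁻¹ ∈ tangent (S : Set (Matrix n n ℝ)) := by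
    intro t ht
    have h1 : diagonal t⁻¹ * diagonal t = (1 : Matrix n n ℝ) := by
      rw [diagonal_mul_diagonal, ← diagonal_one]
      congr 1
      ext i
      simp [ht i]
    have h2 : diagonal t * diagonal t⁻¹ = (1 : Matrix n n ℝ) := by
      rw [diagonal_mul_diagonal, ← diagonal_one]
      congr 1
      ext i
      simp [ht i]
    apply mem_tangent S
    · calc diagonal t * Y * diagonal t⁻¹ * (diagonal t * Y * diagonal t⁻¹)
          = diagonal t * Y * (diagonal t⁻¹ * diagonal t) * Y * diagonal t⁻¹ := by
            simp only [Matrix.mul_assoc]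
        _ = diagonal t * (Y * Y) * diagonal t⁻¹ := by
            rw [h1, Matrix.mul_one, Matrix.mul_assoc (diagonal t)]
        _ = 0 := by rw [hY, Matrix.mul_zero, Matrix.zero_mul]
    · intro s
      have h3 : 1 + s • (diagonal t * Y * diagonal t⁻¹) =
          diagonal t * (1 + s • Y) * diagonal t⁻¹ := by
        rw [mul_add, add_mul, mul_one, h2, mul_smul_comm, smul_mul_assoc]
      rw [h3]
      exact mul_mem_zariskiClosure S (mul_mem_zariskiClosure S (hdiag t) (hYt s)) (hdiag _)
  apply MvPolynomial.funext
  intro x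
  rw [map_zero]
  -- Gaussian elimination: every matrix is a product of diagonal matrices and transvections.
  refine Matrix.diagonal_transvection_induction
    (fun M => M ∈ zariskiClosure (S : Set (Matrix n n ℝ))) (Matrix.of fun i j => x (i, j))
    (fun D _ => hdiag D) (fun τ => ?_) (fun M N hM hN => mul_mem_zariskiClosure S hM hN) P hP
  have h1 := single_mem_of_conj_diagonal_mem _ hL τ.hij (hY0 _ _ τ.hij)
  have h2 := one_add_smul_mem_zariskiClosure (by simp [τ.hij.symm]) hone h1 τ.c
  rwa [Matrix.smul_single, smul_eq_mul, mul_one] at h2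

end MatrixPolynomials

end Density

open Matrix

/-! ### Transfer to generic families -/

section Generic

open MvPolynomial

/-- The matrix of the linear map defined by a word. -/
def wordMatrix {d k : ℕ} (𝓕 : FamilySpace d k) (w : List (Fin k)) : Matrix (Fin d) (Fin d) ℝ :=
  (w.map fun i => Matrix.of fun a b => 𝓕 (i, a, b)).prod

theorem wordMap_eq_toEuclideanLin {d k : ℕ} (𝓕 : FamilySpace d k) (w : List (Fin k)) :
    wordMap 𝓕 w = (Matrix.toEuclideanLin (wordMatrix 𝓕 w) : E d →ₗ[ℝ] E d) := by
  induction w with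
  | nil => exact (Matrix.toLpLin_one 2).symm
  | cons i w ih =>
    have h : wordMap 𝓕 (i :: w) = member 𝓕 i ∘ₗ wordMap 𝓕 w := rfl
    have h' : wordMatrix 𝓕 (i :: w) = (Matrix.of fun a b => 𝓕 (i, a, b)) * wordMatrix 𝓕 w := rfl
    rw [h, h', ih, member]
    exact (Matrix.toLpLin_mul_same 2 _ _).symm

/-- The diagonal matrix with prime diagonal entries. -/
def primeDiagonal (d : ℕ) : Fin d → ℝ := fun i => (Nat.nth Nat.Prime i : ℕ)

theorem primeDiagonal_ne_zero {d : ℕ} (i : Fin d) : primeDiagonal d i ≠ 0 := by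
  simpa [primeDiagonal] using (Nat.prime_nth_prime i).ne_zero

/-- Unique factorization: the exponents are recovered as the prime valuations. -/
theorem primeDiagonal_injective (d : ℕ) :
    Function.Injective fun α : Fin d →₀ ℕ => ∏ i, primeDiagonal d i ^ α i := by
  intro α β h
  have h' : ∏ i : Fin d, Nat.nth Nat.Prime i ^ α i = ∏ i : Fin d, Nat.nth Nat.Prime i ^ β i := by
    simp only [primeDiagonal] at h
    exact_mod_cast h
  have hf : ∀ (γ : Fin d →₀ ℕ) (j : Fin d),
      (∏ i : Fin d, Nat.nth Nat.Prime i ^ γ i).factorization (Nat.nth Nat.Prime j) = γ j := by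
    intro γ j
    rw [Nat.factorization_prod (g := fun i : Fin d => Nat.nth Nat.Prime i ^ γ i)
      fun i _ => pow_ne_zero _ (Nat.prime_nth_prime i).ne_zero]
    simp only [Finsupp.finsetSum_apply]
    rw [Finset.sum_eq_single j]
    · rw [Nat.Prime.factorization_pow (Nat.prime_nth_prime j)]
      simp
    · intro i _ hij
      rw [Nat.Prime.factorization_pow (Nat.prime_nth_prime i), Finsupp.single_apply, if_neg]
      intro hp
      exact hij (Fin.ext (Nat.nth_injective Nat.infinite_setOfPred_prime hp))
    · simp
  ext j
  rw [← hf α j, h', hf β j]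

/-- The matrix all of whose rows are `(1 - d, 1, …, 1)`. -/
def nilpotentMatrix (d : ℕ) : Matrix (Fin d) (Fin d) ℝ :=
  Matrix.of fun _ j => if (j : ℕ) = 0 then 1 - (d : ℝ) else 1

/-- The rows are equal and have sum `(1 - d) + (d - 1) = 0`. -/
theorem nilpotentMatrix_mul_self (d : ℕ) : nilpotentMatrix d * nilpotentMatrix d = 0 := by
  ext i j
  rw [Matrix.mul_apply]
  simp only [nilpotentMatrix, Matrix.of_apply, ← Finset.sum_mul]
  cases d with
  | zero => exact i.elim0
  | succ d =>
    rw [Fin.sum_univ_succ]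
    simp

theorem nilpotentMatrix_apply_ne_zero {d : ℕ} {i j : Fin d} (hij : i ≠ j) :
    nilpotentMatrix d i j ≠ 0 := by
  simp only [nilpotentMatrix, Matrix.of_apply]
  split_ifs with h
  · have hd : (d : ℝ) ≠ 1 := by
      intro hd
      have hd' : d = 1 := by exact_mod_cast hd
      subst hd'
      exact hij (Subsingleton.elim _ _)
    exact sub_ne_zero.2 hd.symm
  · exact one_ne_zero

/-- There is a family such that no non-zero polynomial vanishes on all compositions of its
members. -/
theorem exists_family_zariski_dense (d : ℕ) {k : ℕ} (hk : 2 ≤ k) :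
    ∃ 𝓕 : FamilySpace d k, ∀ P : MvPolynomial (Fin d × Fin d) ℝ,
      (∀ w ≠ [], evalMatrix (wordMatrix 𝓕 w) P = 0) → P = 0 := by
  let 𝓕 : FamilySpace d k := fun q => if (q.1 : ℕ) = 0 then
    diagonal (primeDiagonal d) q.2.1 q.2.2 else (1 + nilpotentMatrix d) q.2.1 q.2.2
  refine ⟨𝓕, fun P hP => ?_⟩
  let S : Subsemigroup (Matrix (Fin d) (Fin d) ℝ) :=
    { carrier := {M | ∃ w ≠ [], M = wordMatrix 𝓕 w}
      mul_mem' := by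
        rintro _ _ ⟨w, hw, rfl⟩ ⟨w', -, rfl⟩
        exact ⟨w ++ w', by simp [hw], by simp [wordMatrix]⟩ }
  refine eq_zero_of_forall_evalMatrix_eq_zero S primeDiagonal_ne_zero (primeDiagonal_injective d)
    (nilpotentMatrix_mul_self d) (fun i j hij => nilpotentMatrix_apply_ne_zero hij)
    ⟨[⟨0, by omega⟩], by simp, ?_⟩ ⟨[⟨1, by omega⟩], by simp, ?_⟩ ?_
  · ext a b
    simp [wordMatrix, 𝓕]
  · ext a b
    simp [wordMatrix, 𝓕]
  · rintro _ ⟨w, hw, rfl⟩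
    exact hP w hw

/-- Given a finite-dimensional space of polynomials in the matrix entries, the families for which
some non-zero polynomial of that space vanishes on all compositions lie in a hypersurface. -/
theorem exists_polynomial_forall_exists_word (d : ℕ) {k : ℕ} (hk : 2 ≤ k)
    (W : Submodule ℝ (MvPolynomial (Fin d × Fin d) ℝ)) [FiniteDimensional ℝ W] :
    ∃ p : MvPolynomial (Fin k × Fin d × Fin d) ℝ, p ≠ 0 ∧ ∀ 𝓕 : FamilySpace d k, eval 𝓕 p ≠ 0 →
      ∀ P ∈ W, P ≠ 0 → ∃ w ≠ [], evalMatrix (wordMatrix 𝓕 w) P ≠ 0 := by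
  obtain ⟨𝓕₀, h₀⟩ := exists_family_zariski_dense d hk
  let N := Module.finrank ℝ W
  let β := Module.finBasis ℝ W
  let v : FamilySpace d k → List (Fin k) → Fin N → ℝ := fun 𝓕 w j =>
    evalMatrix (wordMatrix 𝓕 w) (β j : MvPolynomial (Fin d × Fin d) ℝ)
  have hcomb : ∀ (𝓕 : FamilySpace d k) (w : List (Fin k)) (c : Fin N → ℝ),
      evalMatrix (wordMatrix 𝓕 w) ((∑ j, c j • β j : W) : MvPolynomial (Fin d × Fin d) ℝ) =
        ∑ j, c j * v 𝓕 w j := by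
    intro 𝓕 w c
    simp [evalMatrix, v, MvPolynomial.smul_eval]
  let s : Set (Fin N → ℝ) := {x | ∃ w ≠ [], x = v 𝓕₀ w}
  -- Otherwise a non-zero functional kills all evaluation vectors; its coefficients form a non-zero
  -- element of `W` that vanishes on all words of `𝓕₀`, against density.
  have hspan : Submodule.span ℝ s = ⊤ := by
    by_contra hne
    obtain ⟨f, hf, hle⟩ := Submodule.exists_le_ker_of_lt_top _ (lt_top_iff_ne_top.2 hne)
    apply hf
    let c : Fin N → ℝ := fun j => f (Pi.single j 1)
    have hfc : ∀ x, f x = ∑ j, c j * x j := by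
      intro x
      rw [LinearMap.pi_apply_eq_sum_univ f x]
      refine Finset.sum_congr rfl fun j _ => ?_
      rw [smul_eq_mul, mul_comm]
      congr 2
      ext l
      simp [Pi.single_apply, eq_comm]
    have hzero := h₀ _ fun w hw => by
      rw [hcomb 𝓕₀ w c, ← hfc]
      exact hle (Submodule.subset_span ⟨w, hw, rfl⟩)
    have hc := Fintype.linearIndependent_iff.1 β.linearIndependent c (by
      apply Subtype.ext
      exact hzero)
    ext j
    simp [c] at hc
    simp [hc]
  have hN : Module.finrank ℝ (Submodule.span ℝ s) = N := by
    rw [hspan, finrank_top, Module.finrank_fin_fun]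
  obtain ⟨f, hfs, -, hli⟩ := Submodule.exists_fun_fin_finrank_span_eq ℝ s
  choose w hw hfw using hfs
  let e : Fin N ≃ Fin (Module.finrank ℝ (Submodule.span ℝ s)) := finCongr hN.symm
  let G : Fin k → Matrix (Fin d) (Fin d) (MvPolynomial (Fin k × Fin d × Fin d) ℝ) := fun i =>
    Matrix.of fun a b => X (i, a, b)
  -- The `N` chosen words are kept while the family varies: the determinant of their evaluation
  -- vectors is a polynomial in the family, non-zero at `𝓕₀`.
  let D : Matrix (Fin N) (Fin N) (MvPolynomial (Fin k × Fin d × Fin d) ℝ) := Matrix.of fun r j =>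
    aeval (fun q : Fin d × Fin d => ((w (e r)).map G).prod q.1 q.2)
      (β j : MvPolynomial (Fin d × Fin d) ℝ)
  have hword : ∀ (𝓕 : FamilySpace d k) (w : List (Fin k)),
      ((w.map G).prod).map (eval 𝓕) = wordMatrix 𝓕 w := by
    intro 𝓕 w
    induction w with
    | nil => simp [wordMatrix]
    | cons i w ih =>
      rw [List.map_cons, List.prod_cons, Matrix.map_mul, ih]
      simp only [wordMatrix, List.map_cons, List.prod_cons]
      congr 1
      ext a b
      simp [G]
  have hD : ∀ 𝓕 : FamilySpace d k,
      eval 𝓕 D.det = (Matrix.of fun r j => v 𝓕 (w (e r)) j).det := by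
    intro 𝓕
    rw [RingHom.map_det]
    congr 1
    ext r j
    have : (aeval (R := ℝ) 𝓕).comp
        (aeval fun q : Fin d × Fin d => ((w (e r)).map G).prod q.1 q.2) =
        aeval fun q : Fin d × Fin d => wordMatrix 𝓕 (w (e r)) q.1 q.2 := by
      ext q
      rw [← hword]
      simp
    exact DFunLike.congr_fun this (β j : MvPolynomial (Fin d × Fin d) ℝ)
  refine ⟨D.det, fun h0 => ?_, fun 𝓕 h𝓕 P hP hP0 => ?_⟩
  · have h1 := hD 𝓕₀
    rw [h0, map_zero] at h1
    have hrows : LinearIndependent ℝ (Matrix.of fun r j => v 𝓕₀ (w (e r)) j).row := by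
      have hrow : (Matrix.of fun r j => v 𝓕₀ (w (e r)) j).row = f ∘ e := by
        ext r j
        simp [hfw]
      rw [hrow]
      exact hli.comp e e.injective
    have hu := Matrix.linearIndependent_rows_iff_isUnit.1 hrows
    rw [Matrix.isUnit_iff_isUnit_det, ← h1] at hu
    exact not_isUnit_zero hu
  · by_contra! hall
    rw [hD] at h𝓕
    have hrepr := β.sum_repr ⟨P, hP⟩
    have hmul : (Matrix.of fun r j => v 𝓕 (w (e r)) j).mulVec (β.repr ⟨P, hP⟩) = 0 := by
      ext r
      have h1 := hcomb 𝓕 (w (e r)) (β.repr ⟨P, hP⟩)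
      rw [hrepr] at h1
      have h2 := hall _ (hw (e r))
      rw [h1] at h2
      simp only [Matrix.mulVec, dotProduct, Matrix.of_apply, Pi.zero_apply]
      rw [← h2]
      exact Finset.sum_congr rfl fun j _ => mul_comm _ _
    have h3 := Matrix.eq_zero_of_mulVec_eq_zero h𝓕 hmul
    apply hP0
    have h4 : (⟨P, hP⟩ : W) = 0 := by
      rw [← hrepr]
      simp [h3]
    exact congrArg Subtype.val h4

/-- `frameDet S a b` as a polynomial in the entries of the matrix of `S`. -/
def framePolynomial {d m : ℕ} (a b : Fin m → E d) : MvPolynomial (Fin d × Fin d) ℝ :=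
  Matrix.det (Matrix.of fun i j => ∑ q : Fin d × Fin d, C (b i q.1 * a j q.2) * X q)

theorem evalMatrix_framePolynomial {d m : ℕ} (a b : Fin m → E d) (M : Matrix (Fin d) (Fin d) ℝ) :
    evalMatrix M (framePolynomial a b) = frameDet (Matrix.toEuclideanLin M) a b := by
  rw [evalMatrix, framePolynomial, RingHom.map_det, frameDet]
  congr 1
  ext i j
  simp [PiLp.inner_apply, Matrix.mulVec, dotProduct, Fintype.sum_prod_type, Finset.mul_sum,
    Matrix.toLpLin_apply]
  refine Finset.sum_congr rfl fun x _ => Finset.sum_congr rfl fun y _ => by ring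

theorem totalDegree_framePolynomial_le {d m : ℕ} (a b : Fin m → E d) :
    (framePolynomial a b).totalDegree ≤ m := by
  rw [framePolynomial, Matrix.det_apply]
  refine MvPolynomial.totalDegree_finsetSum_le fun τ _ => ?_
  refine (MvPolynomial.totalDegree_smul_le _ _).trans ?_
  refine (MvPolynomial.totalDegree_finsetProd _ _).trans ?_
  refine (Finset.sum_le_card_nsmul _ _ 1 fun i _ => ?_).trans (by simp)
  refine MvPolynomial.totalDegree_finsetSum_le fun q _ => ?_
  exact (MvPolynomial.totalDegree_mul _ _).trans (by rw [totalDegree_C, totalDegree_X, zero_add])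

/-- Some linear map takes one orthonormal frame to another one. -/
theorem exists_matrix_map_frame {d m : ℕ} {a : Fin m → E d} (ha : Orthonormal ℝ a)
    (b : Fin m → E d) : ∃ M : Matrix (Fin d) (Fin d) ℝ, ∀ i, Matrix.toEuclideanLin M (a i) = b i := by
  let f : E d →ₗ[ℝ] E d := ∑ i, (innerₗ (E d) (a i)).smulRight (b i)
  refine ⟨Matrix.toEuclideanLin.symm f, fun i => ?_⟩
  rw [LinearEquiv.apply_symm_apply]
  simp [f, orthonormal_iff_ite.1 ha]

theorem frameDet_eq_one {d m : ℕ} {a b : Fin m → E d} (hb : Orthonormal ℝ b) {S : E d →ₗ[ℝ] E d}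
    (h : ∀ i, S (a i) = b i) : frameDet S a b = 1 := by
  rw [frameDet, ← Matrix.det_one (n := Fin m) (R := ℝ)]
  congr 1
  ext i j
  rw [Matrix.of_apply, h, orthonormal_iff_ite.1 hb, Matrix.one_apply]
  simp [eq_comm]

/-- The families outside `typicalSet d k` lie in a hypersurface. -/
theorem exists_polynomial_mem_typicalSet (d : ℕ) {k : ℕ} (hk : 2 ≤ k) :
    ∃ p : MvPolynomial (Fin k × Fin d × Fin d) ℝ, p ≠ 0 ∧
      ∀ 𝓕 : FamilySpace d k, eval 𝓕 p ≠ 0 → 𝓕 ∈ typicalSet d k := by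
  obtain ⟨p, hp, h⟩ := exists_polynomial_forall_exists_word d hk
    -- A product of two frame polynomials has degree at most `m + (m + 1)`, and `m < d`.
    (restrictTotalDegree (Fin d × Fin d) ℝ (2 * d))
  refine ⟨p, hp, fun 𝓕 h𝓕 => mem_typicalSet_of_words ?_ ?_⟩
  · intro m hm a b ha hb
    obtain ⟨M, hM⟩ := exists_matrix_map_frame ha b
    obtain ⟨w, hw, hne⟩ := h 𝓕 h𝓕 (framePolynomial a b)
      ((mem_restrictTotalDegree _ _ _).2 ((totalDegree_framePolynomial_le a b).trans (by omega)))
      (by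
        intro h0
        have h1 := evalMatrix_framePolynomial a b M
        rw [h0, frameDet_eq_one hb hM] at h1
        simp [evalMatrix] at h1)
    rw [evalMatrix_framePolynomial, ← wordMap_eq_toEuclideanLin] at hne
    exact ⟨w, hw, hne⟩
  · intro m hm a b ha hb
    -- The map taking `a` to `b` also takes the truncated frame to the truncated frame, so both
    -- determinants equal `1` and the product polynomial is non-zero.
    obtain ⟨M, hM⟩ := exists_matrix_map_frame ha b
    have heval : ∀ M, evalMatrix M (framePolynomial (Fin.init a) (Fin.init b) * framePolynomial a b) =
        frameDet (Matrix.toEuclideanLin M) (Fin.init a) (Fin.init b) *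
          frameDet (Matrix.toEuclideanLin M) a b := by
      intro M
      rw [← evalMatrix_framePolynomial, ← evalMatrix_framePolynomial]
      simp [evalMatrix]
    obtain ⟨w, hw, hne⟩ := h 𝓕 h𝓕 (framePolynomial (Fin.init a) (Fin.init b) * framePolynomial a b)
      ((mem_restrictTotalDegree _ _ _).2 ((totalDegree_mul _ _).trans ((add_le_add
        (totalDegree_framePolynomial_le _ _) (totalDegree_framePolynomial_le _ _)).trans (by omega))))
      (by
        intro h0
        have h1 := heval M
        have h2 : frameDet (Matrix.toEuclideanLin M) (Fin.init a) (Fin.init b) = 1 :=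
          frameDet_eq_one (hb.comp _ (Fin.castSucc_injective m)) fun i => hM i.castSucc
        rw [h0, frameDet_eq_one hb hM, h2] at h1
        simp [evalMatrix] at h1)
    rw [heval, ← wordMap_eq_toEuclideanLin] at hne
    exact ⟨w, hw, left_ne_zero_of_mul hne, right_ne_zero_of_mul hne⟩

end Generic

end FalconerSloan

end

theorem corollary2p5 (d k : ℕ) (hk : 2 ≤ k) :
    IsOpen (FalconerSloan.typicalSet d k) ∧
    Dense (FalconerSloan.typicalSet d k) ∧
    MeasureTheory.volume (FalconerSloan.typicalSet d k)ᶜ = 0 ∧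
    ∃ 𝒱 : Set (Set (FalconerSloan.FamilySpace d k)), 𝒱.Finite ∧
      (∀ V ∈ 𝒱, FalconerSloan.IsAlgebraicVariety V ∧
        FalconerSloan.algebraicDim V + 1 = ((d ^ 2 * k : ℕ) : WithBot ℕ∞)) ∧
      (FalconerSloan.typicalSet d k)ᶜ ⊆ ⋃₀ 𝒱 := by
  obtain ⟨p, hp, h⟩ := FalconerSloan.exists_polynomial_mem_typicalSet d hk
  have hsub : (FalconerSloan.typicalSet d k)ᶜ ⊆ {𝓕 | MvPolynomial.eval 𝓕 p = 0} := by
    intro 𝓕 h𝓕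
    by_contra hne
    exact h𝓕 (h 𝓕 hne)
  have hnull : MeasureTheory.volume (FalconerSloan.typicalSet d k)ᶜ = 0 :=
    MeasureTheory.measure_mono_null hsub (FalconerSloan.volume_eval_eq_zero hp)
  refine ⟨FalconerSloan.isOpen_typicalSet d k, MeasureTheory.Measure.dense_of_ae hnull, hnull, ?_⟩
  rcases isEmpty_or_nonempty (Fin k × Fin d × Fin d) with hemp | ⟨⟨q⟩⟩
  -- Without coordinates (`d = 0`) a non-zero polynomial has no zeros, so the complement is empty
  -- and no variety is needed.
  · refine ⟨∅, Set.finite_empty, by simp, ?_⟩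
    intro 𝓕 h𝓕
    refine absurd (hsub h𝓕) fun h0 => hp (MvPolynomial.funext fun x => ?_)
    rw [Subsingleton.elim x 𝓕, map_zero]
    exact h0
  · refine ⟨{MvPolynomial.zeroLocus ℝ (Ideal.span {p * MvPolynomial.X q})}, Set.finite_singleton _,
      ?_, ?_⟩
    · rintro _ rfl
      refine ⟨⟨_, rfl⟩, ?_⟩
      rw [FalconerSloan.algebraicDim_zeroLocus_mul_X hp q]
      congr 2
      simp only [Fintype.card_prod, Fintype.card_fin]
      ring
    · rw [Set.sUnion_singleton, MvPolynomial.zeroLocus_span]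
      intro 𝓕 h𝓕
      have h0 : MvPolynomial.eval 𝓕 p = 0 := hsub h𝓕
      simp [h0]
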